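/- Let $G$ be a countable discrete group and $H\le G$ a subgroup with the spectral gap property: the trivial representation $1_H$ is not weakly contained in the natural unitary representation of $H$ on $\ell^2(G/H\setminus\{H\})$. (Here a unitary representation $\rho$ of a group $\Gamma$ is weakly contained in $\pi$ if $\|\rho(x)\|\le\|\pi(x)\|$ for all $x\in C^*(\Gamma)$, equivalently for all $x\in\mathbf{C}[\Gamma]$.) Let $\sigma$ be an irreducible unitary representation of $H$ on a finite-dimensional complex Hilbert space $\mathcal K$, and let $\pi=\operatorname{Ind}_H^G\sigma$ be the induced representation, acting by $(\pi(g)F)(x)=F(g^{-1}x)$ on the Hilbert space $\mathcal H$ of maps $F:G\to\mathcal K$ with $F(xh)=\sigma(h^{-1})F(x)$ for all $x\in G$, $h\in H$ and $\sum_{x\in G/H}\|F(x)\|^2<\infty$. Let $C^*_\pi(G)$ be the norm closure in $\mathcal B(\mathcal H)$ of $\{\sum_{s\in G} f(s)\pi(s) : f\in\mathbf{C}[G]\}$. Then $C^*_\pi(G)$ has a unique smallest nonzero closed two-sided ideal $I_{\min}$, that is, a nonzero closed two-sided ideal contained in every nonzero closed two-sided ideal of $C^*_\pi(G)$; moreover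 $I_{\min}=\mathcal K(\mathcal H)$, the algebra of all compact operators on $\mathcal H$ (in particular, $\mathcal K(\mathcal H)\subset C^*_\pi(G)$). -/

import Mathlib

noncomputable section

namespace SpectralGapInd

/-- Unitary representations of the discrete group `G` on the Hilbert space `E`. -/
abbrev URep (G : Type*) [Group G] (E : Type*) [NormedAddCommGroup E] [InnerProductSpace ℂ E]
    [CompleteSpace E] :=
  G →* unitary (E →L[ℂ] E)

section General

variable {G : Type*} [Group G] {E : Type*} [NormedAddCommGroup E] [InnerProductSpace ℂ E]
  [CompleteSpace E] {F : Type*} [NormedAddCommGroup F] [InnerProductSpace ℂ F] [CompleteSpace F]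

/-- A linear action of `G` by norm-preserving maps, as a unitary representation. -/
def URep.ofIsometric (U : G →* Module.End ℂ E) (hU : ∀ g v, ‖U g v‖ = ‖v‖) : URep G E :=
  (Unitary.linearIsometryEquiv (𝕜 := ℂ) (H := E)).symm.toMonoidHom.comp
    { toFun := fun g =>
        { toFun := U g
          map_add' := map_add (U g)
          map_smul' := map_smul (U g)
          invFun := U g⁻¹
          left_inv := fun v => by
            rw [← Module.End.mul_apply, ← map_mul, inv_mul_cancel, map_one, Module.End.one_apply]
          right_inv := fun v => by
            rw [← Module.End.mul_apply, ← map_mul, mul_inv_cancel, map_one, Module.End.one_apply]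
          norm_map' := hU g }
      map_one' := by ext v; exact congrArg (fun T : Module.End ℂ E => T v) (map_one U)
      map_mul' := fun g h => by
        ext v; exact congrArg (fun T : Module.End ℂ E => T v) (map_mul U g h) }

theorem URep.ofIsometric_apply (U : G →* Module.End ℂ E) (hU : ∀ g v, ‖U g v‖ = ‖v‖)
    (g : G) (v : E) : (URep.ofIsometric U hU g : E →L[ℂ] E) v = U g v := rfl

/-- Irreducibility: the space is nonzero and has no closed invariant subspaces other than
`0` and itself. -/
def URep.IsIrreducible (π : URep G E) : Prop :=
  Nontrivial E ∧ ∀ W : Submodule ℂ E, IsClosed (W : Set E) →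
    (∀ g : G, ∀ v ∈ W, (π g : E →L[ℂ] E) v ∈ W) → W = ⊥ ∨ W = ⊤

/-- The extension of `π` to the group algebra, `f ↦ ∑ f(s) π(s)`. -/
def URep.toAlgHom (π : URep G E) : MonoidAlgebra ℂ G →ₐ[ℂ] (E →L[ℂ] E) :=
  MonoidAlgebra.lift ℂ (E →L[ℂ] E) G ((unitary (E →L[ℂ] E)).subtype.comp π)

theorem URep.toAlgHom_single (π : URep G E) (g : G) (c : ℂ) :
    π.toAlgHom (MonoidAlgebra.single g c) = c • (π g : E →L[ℂ] E) := by
  simp [URep.toAlgHom]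

theorem URep.star_toAlgHom_mem (π : URep G E) (f : MonoidAlgebra ℂ G) :
    star (π.toAlgHom f) ∈ π.toAlgHom.range := by
  induction f using MonoidAlgebra.induction_linear with
  | zero => simp
  | add f₁ f₂ h₁ h₂ => rw [map_add, star_add]; exact add_mem h₁ h₂
  | single g c =>
    refine ⟨MonoidAlgebra.single g⁻¹ (star c), ?_⟩
    change π.toAlgHom _ = _
    rw [URep.toAlgHom_single, URep.toAlgHom_single, star_smul, map_inv]
    rfl

/-- The `*`-algebra `{π(f) | f ∈ ℂ[G]}`. -/
def URep.starAlg (π : URep G E) : StarSubalgebra ℂ (E →L[ℂ] E) :=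
  { π.toAlgHom.range with
    star_mem' := by
      rintro _ ⟨f, rfl⟩
      exact π.star_toAlgHom_mem f }

/-- The C⋆-algebra generated by `π`: the operator-norm closure of `{π(f) | f ∈ ℂ[G]}`. -/
def URep.cstar (π : URep G E) : StarSubalgebra ℂ (E →L[ℂ] E) :=
  π.starAlg.topologicalClosure

/-- Weak containment `ρ ≺ π`: `‖ρ(x)‖ ≤ ‖π(x)‖` for all `x`. Both sides are continuous in `x`
for the norm of the maximal C⋆-algebra of `G`, in which the group algebra is dense, so it is the
same to let `x` run over the group algebra. -/
def URep.WeaklyContained (ρ : URep G F) (π : URep G E) : Prop :=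
  ∀ x : MonoidAlgebra ℂ G, ‖ρ.toAlgHom x‖ ≤ ‖π.toAlgHom x‖

end General

section Permutation

variable {G : Type*} [Group G] {X : Type*} [MulAction G X]

/-- The complex Hilbert space `ℓ²(X)`. -/
abbrev Ell2 (X : Type*) := lp (fun _ : X => ℂ) 2

theorem memℓp_two_iff {ι E : Type*} [NormedAddCommGroup E] (f : ι → E) :
    Memℓp f 2 ↔ Summable fun i => ‖f i‖ ^ 2 := by
  rw [memℓp_gen_iff (by norm_num)]
  norm_num

theorem norm_sq_eq_tsum {ι E : Type*} [NormedAddCommGroup E] (f : lp (fun _ : ι => E) 2) :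
    ‖f‖ ^ 2 = ∑' i, ‖f i‖ ^ 2 := by
  have h := lp.norm_rpow_eq_tsum (p := 2) (by norm_num) f
  norm_num at h
  exact h

/-- Translation on `ℓ²(X)`: `(g f)(x) = f(g⁻¹ x)`. -/
def permEnd (G : Type*) [Group G] (X : Type*) [MulAction G X] : G →* Module.End ℂ (Ell2 X) where
  toFun g :=
    { toFun := fun f => ⟨fun x => f (g⁻¹ • x), by
        have hf := (memℓp_two_iff _).1 f.2
        exact (memℓp_two_iff _).2 ((MulAction.toPerm (β := X) g⁻¹).summable_iff.2 hf)⟩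
      map_add' := fun f₁ f₂ => rfl
      map_smul' := fun c f => rfl }
  map_one' := by
    ext f x
    change f ((1 : G)⁻¹ • x) = f x
    rw [inv_one, one_smul]
  map_mul' g h := by
    ext f x
    change f ((g * h)⁻¹ • x) = f (h⁻¹ • g⁻¹ • x)
    rw [mul_inv_rev, mul_smul]

theorem norm_permEnd (g : G) (f : Ell2 X) : ‖permEnd G X g f‖ = ‖f‖ := by
  rw [← sq_eq_sq₀ (norm_nonneg _) (norm_nonneg _), norm_sq_eq_tsum, norm_sq_eq_tsum]
  exact (MulAction.toPerm (β := X) g⁻¹).tsum_eq fun x => ‖f x‖ ^ 2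

/-- The natural representation of `G` on `ℓ²(X)` for an action of `G` on the set `X`. -/
def permRep (G : Type*) [Group G] (X : Type*) [MulAction G X] : URep G (Ell2 X) :=
  URep.ofIsometric (permEnd G X) norm_permEnd

theorem permRep_apply (g : G) (f : Ell2 X) (x : X) :
    (permRep G X g : Ell2 X →L[ℂ] Ell2 X) f x = f (g⁻¹ • x) := rfl

/-- The action of `G` on `X` has a spectral gap: the trivial one-dimensional representation is not
weakly contained in the natural representation on `ℓ²(X)`. -/
def HasSpectralGap (G : Type*) [Group G] (X : Type*) [MulAction G X] : Prop :=
  ¬ URep.WeaklyContained (1 : URep G ℂ) (permRep G X)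

/-- The `H`-invariant set `G/H ∖ {H}`. -/
def cosetsNeBase {G : Type*} [Group G] (H : Subgroup G) : SubMulAction H (G ⧸ H) where
  carrier := {((1 : G) : G ⧸ H)}ᶜ
  smul_mem' := by
    intro h q hq hq'
    apply hq
    have hb : h • (((1 : G) : G ⧸ H)) = ((1 : G) : G ⧸ H) := by
      change (((h : G) * 1 : G) : G ⧸ H) = ((1 : G) : G ⧸ H)
      rw [mul_one, QuotientGroup.eq]
      simp
    have hq'' : h • q = ((1 : G) : G ⧸ H) := hq'
    rw [← hb] at hq''
    exact MulAction.injective h hq''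

/-- The subgroup `H` of `G` has the spectral gap property. -/
def SpectralGapProperty {G : Type*} [Group G] (H : Subgroup G) : Prop :=
  HasSpectralGap H (cosetsNeBase H)

end Permutation

section Induced

variable {G : Type*} [Group G] {H : Subgroup G} {K : Type*} [NormedAddCommGroup K]
  [InnerProductSpace ℂ K] [CompleteSpace K]

/-- The maps `F : G → K` with `F(xh) = σ(h⁻¹) F(x)` and `∑_{x ∈ G/H} ‖F(x)‖² < ∞`. By the first
condition `‖F(x)‖` depends only on the coset `xH`; the sum is formed with the representatives
`q.out`. -/
def indSubmodule (σ : URep H K) : Submodule ℂ (G → K) where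
  carrier := {F | (∀ (x : G) (h : H), F (x * h) = (σ h⁻¹ : K →L[ℂ] K) (F x)) ∧
    Summable fun q : G ⧸ H => ‖F q.out‖ ^ 2}
  zero_mem' := ⟨fun x h => by simp, by simp⟩
  add_mem' := by
    rintro F₁ F₂ ⟨h₁, s₁⟩ ⟨h₂, s₂⟩
    refine ⟨fun x h => by simp [h₁, h₂], ?_⟩
    rw [← memℓp_two_iff (fun q : G ⧸ H => F₁ q.out)] at s₁
    rw [← memℓp_two_iff (fun q : G ⧸ H => F₂ q.out)] at s₂
    exact (memℓp_two_iff _).1 (s₁.add s₂)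
  smul_mem' := by
    rintro c F ⟨h, s⟩
    refine ⟨fun x k => by simp [h], ?_⟩
    rw [← memℓp_two_iff (fun q : G ⧸ H => F q.out)] at s
    exact (memℓp_two_iff _).1 (s.const_smul c)

/-- The space of the induced representation. It is a type of its own, so that it does not inherit
the topology of pointwise convergence. -/
def IndSpace (σ : URep H K) : Type _ := indSubmodule σ

instance (σ : URep H K) : AddCommGroup (IndSpace σ) :=
  inferInstanceAs (AddCommGroup (indSubmodule σ))

instance (σ : URep H K) : Module ℂ (IndSpace σ) :=
  inferInstanceAs (Module ℂ (indSubmodule σ))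

instance (σ : URep H K) : FunLike (IndSpace σ) G K where
  coe F := Subtype.val (p := fun F : G → K => F ∈ indSubmodule σ) F
  coe_injective _ _ h := Subtype.ext h

/-- An element of the space of the induced representation from its two defining properties. -/
def IndSpace.mk {σ : URep H K} (F : G → K)
    (h₁ : ∀ (x : G) (h : H), F (x * h) = (σ h⁻¹ : K →L[ℂ] K) (F x))
    (h₂ : Summable fun q : G ⧸ H => ‖F q.out‖ ^ 2) : IndSpace σ :=
  (⟨F, h₁, h₂⟩ : indSubmodule σ)

theorem IndSpace.mk_apply {σ : URep H K} (F : G → K)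
    (h₁ : ∀ (x : G) (h : H), F (x * h) = (σ h⁻¹ : K →L[ℂ] K) (F x))
    (h₂ : Summable fun q : G ⧸ H => ‖F q.out‖ ^ 2) (x : G) : IndSpace.mk F h₁ h₂ x = F x := rfl

theorem IndSpace.ext {σ : URep H K} {F₁ F₂ : IndSpace σ} (h : ∀ x, F₁ x = F₂ x) : F₁ = F₂ :=
  DFunLike.ext F₁ F₂ h

theorem IndSpace.apply_mul {σ : URep H K} (F : IndSpace σ) (x : G) (h : H) :
    F (x * h) = (σ h⁻¹ : K →L[ℂ] K) (F x) :=
  (Subtype.property (p := fun F : G → K => F ∈ indSubmodule σ) F).1 x h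

theorem IndSpace.summable {σ : URep H K} (F : IndSpace σ) :
    Summable fun q : G ⧸ H => ‖F q.out‖ ^ 2 :=
  (Subtype.property (p := fun F : G → K => F ∈ indSubmodule σ) F).2

theorem IndSpace.norm_apply_mul {σ : URep H K} (F : IndSpace σ) (x : G) (h : H) :
    ‖F (x * h)‖ = ‖F x‖ := by
  rw [F.apply_mul x h, Unitary.norm_map]

theorem IndSpace.norm_apply_eq {σ : URep H K} (F : IndSpace σ) {x y : G}
    (hxy : (x : G ⧸ H) = (y : G ⧸ H)) : ‖F x‖ = ‖F y‖ := by
  have h := F.norm_apply_mul x ⟨x⁻¹ * y, QuotientGroup.eq.1 hxy⟩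
  rw [← h]
  simp

/-- Restriction to coset representatives identifies the space with `ℓ²(G/H, K)`. -/
def IndSpace.toLp (σ : URep H K) : IndSpace σ ≃ₗ[ℂ] lp (fun _ : G ⧸ H => K) 2 where
  toFun F := ⟨fun q => F q.out, (memℓp_two_iff _).2 F.summable⟩
  map_add' F₁ F₂ := rfl
  map_smul' c F := rfl
  invFun f := IndSpace.mk
    (fun x => (σ ⟨x⁻¹ * (x : G ⧸ H).out, QuotientGroup.eq.1 (by simp)⟩ : K →L[ℂ] K)
      (f (x : G ⧸ H)))
    (fun x h => by
      have hq : ((x * h : G) : G ⧸ H) = (x : G ⧸ H) := by simp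
      rw [← mul_apply_eq_comp, ← Submonoid.coe_mul, ← map_mul]
      simp only [hq]
      congr 4
      simp [mul_assoc])
    (((memℓp_two_iff _).1 f.2).congr fun q => by
      rw [Unitary.norm_map]
      simp)
  left_inv F := by
    apply IndSpace.ext
    intro x
    have hx : (x : G ⧸ H) = ((x : G ⧸ H).out : G ⧸ H) := by simp
    have h := F.apply_mul x ⟨x⁻¹ * (x : G ⧸ H).out, QuotientGroup.eq.1 hx⟩
    simp only [mul_inv_cancel_left] at h
    rw [IndSpace.mk_apply]
    change (σ _ : K →L[ℂ] K) (F _) = F x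
    rw [h, ← mul_apply_eq_comp, ← Submonoid.coe_mul, ← map_mul]
    simp
  right_inv f := by
    ext q
    change (σ _ : K →L[ℂ] K) (f ((q.out : G) : G ⧸ H)) = f q
    have hq : ((q.out : G) : G ⧸ H) = q := by simp
    have h1 : (⟨q.out⁻¹ * ((q.out : G) : G ⧸ H).out, QuotientGroup.eq.1 (by simp)⟩ : H) = 1 := by
      ext
      simp
    rw [h1, map_one, hq]
    rfl

/-- The norm is `‖F‖ = (∑_{x ∈ G/H} ‖F(x)‖²)^(1/2)`. -/
instance (σ : URep H K) : NormedAddCommGroup (IndSpace σ) :=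
  NormedAddCommGroup.induced (IndSpace σ) (lp (fun _ : G ⧸ H => K) 2)
    (IndSpace.toLp σ).toLinearMap (IndSpace.toLp σ).injective

theorem IndSpace.norm_toLp {σ : URep H K} (F : IndSpace σ) : ‖IndSpace.toLp σ F‖ = ‖F‖ := rfl

theorem IndSpace.norm_sq {σ : URep H K} (F : IndSpace σ) :
    ‖F‖ ^ 2 = ∑' q : G ⧸ H, ‖F q.out‖ ^ 2 :=
  norm_sq_eq_tsum (IndSpace.toLp σ F)

/-- The inner product is `∑_{x ∈ G/H} ⟪F₁(x), F₂(x)⟫`. -/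
instance (σ : URep H K) : InnerProductSpace ℂ (IndSpace σ) where
  norm_smul_le c F := by
    rw [← IndSpace.norm_toLp, map_smul, norm_smul, IndSpace.norm_toLp]
  inner F₁ F₂ := inner ℂ (IndSpace.toLp σ F₁) (IndSpace.toLp σ F₂)
  norm_sq_eq_re_inner F := norm_sq_eq_re_inner (𝕜 := ℂ) (IndSpace.toLp σ F)
  conj_inner_symm F₁ F₂ := inner_conj_symm (𝕜 := ℂ) (IndSpace.toLp σ F₁) (IndSpace.toLp σ F₂)
  add_left F₁ F₂ F₃ := by rw [map_add, inner_add_left]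
  smul_left F₁ F₂ c := by rw [map_smul, inner_smul_left]

theorem IndSpace.inner_eq {σ : URep H K} (F₁ F₂ : IndSpace σ) :
    inner ℂ F₁ F₂ = ∑' q : G ⧸ H, inner ℂ (F₁ q.out) (F₂ q.out) := rfl

instance (σ : URep H K) : CompleteSpace (IndSpace σ) := by
  let e : IndSpace σ ≃ₗᵢ[ℂ] lp (fun _ : G ⧸ H => K) 2 :=
    { IndSpace.toLp σ with norm_map' := IndSpace.norm_toLp }
  exact e.toIsometryEquiv.completeSpace

theorem IndSpace.norm_translate {σ : URep H K} (F : IndSpace σ) (g : G) (q : G ⧸ H) :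
    ‖F (g⁻¹ * q.out)‖ = ‖F (MulAction.toPerm (β := G ⧸ H) g⁻¹ q).out‖ := by
  apply F.norm_apply_eq
  rw [QuotientGroup.out_eq']
  change g⁻¹ • ((q.out : G) : G ⧸ H) = g⁻¹ • q
  rw [QuotientGroup.out_eq']

/-- Left translation `(g F)(x) = F(g⁻¹ x)`. -/
def indEnd (σ : URep H K) : G →* Module.End ℂ (IndSpace σ) where
  toFun g :=
    { toFun := fun F => IndSpace.mk (fun x => F (g⁻¹ * x))
        (fun x h => by rw [← mul_assoc, F.apply_mul])
        (by
          simp only [IndSpace.norm_translate F g]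
          exact (MulAction.toPerm (β := G ⧸ H) g⁻¹).summable_iff.2 F.summable)
      map_add' := fun F₁ F₂ => rfl
      map_smul' := fun c F => rfl }
  map_one' := by
    refine LinearMap.ext fun F => IndSpace.ext fun x => ?_
    change F ((1 : G)⁻¹ * x) = F x
    simp
  map_mul' g h := by
    refine LinearMap.ext fun F => IndSpace.ext fun x => ?_
    change F ((g * h)⁻¹ * x) = F (h⁻¹ * (g⁻¹ * x))
    rw [mul_inv_rev, mul_assoc]

theorem norm_indEnd (σ : URep H K) (g : G) (F : IndSpace σ) : ‖indEnd σ g F‖ = ‖F‖ := by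
  rw [← sq_eq_sq₀ (norm_nonneg _) (norm_nonneg _), IndSpace.norm_sq, IndSpace.norm_sq]
  change ∑' q : G ⧸ H, ‖F (g⁻¹ * q.out)‖ ^ 2 = _
  simp only [IndSpace.norm_translate F g]
  exact (MulAction.toPerm (β := G ⧸ H) g⁻¹).tsum_eq fun q => ‖F q.out‖ ^ 2

/-- The induced representation `Ind_H^G σ`, acting by left translation. -/
def indRep (σ : URep H K) : URep G (IndSpace σ) :=
  URep.ofIsometric (indEnd σ) (norm_indEnd σ)

theorem indRep_apply (σ : URep H K) (g : G) (F : IndSpace σ) (x : G) :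
    (indRep σ g : IndSpace σ →L[ℂ] IndSpace σ) F x = F (g⁻¹ * x) := rfl

end Induced

/-- The nonzero closed two-sided ideals of a topological ring. -/
def nonzeroClosedIdeals (A : Type*) [Ring A] [TopologicalSpace A] : Set (TwoSidedIdeal A) :=
  {J | IsClosed (J : Set A) ∧ J ≠ ⊥}

end SpectralGapInd

end

/-!
Let `λ` be the representation of `H` on `ℓ²(G/H ∖ {H})`, `π = Ind σ`, and `V F = F(1)`. The adjoint
of `V` is an isometry onto the functions supported in `H`, and it intertwines `σ` with `π|_H`.

By uniform convexity, the spectral gap yields a finitely supported probability measure `y` on `H`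
with `‖λ(y)‖ < 1`. For `φ : H → ℂ` with `|φ| ≤ 1`, let `T_n = ∑_s yⁿ(s) φ(s) π(s)`. On the functions
vanishing at `1` the operator `T_n` is dominated coset by coset by `λ(yⁿ)`, hence tends to zero. On
the range of `V*` it acts as `t_n = ∑_s yⁿ(s) φ(s) σ(s)`, and for some matrix coefficient
`φ_i(s) = ⟪σ(s) v, b_i⟫` of `σ` these do not tend to zero, since for a unit vector `v` and an
orthonormal basis `b` the sum of the `⟪b_i, t_n v⟫` over `φ = φ_i` is `∑_s yⁿ(s) ‖σ(s) v‖² = 1`.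
So `C*_π(G)` contains `V* t V` for some `t ≠ 0`. By Burnside's theorem it contains all `V* t V`,
in particular rank-one operators, and by translating them it contains all rank-one operators. Any
C⋆-algebra containing the rank-one operators contains the compact operators as its least nonzero
closed ideal.
-/

namespace SpectralGapInd

open InnerProductSpace Filter Topology
open scoped NNReal InnerProduct

section CompactOperators

variable {𝕜 : Type*} [RCLike 𝕜] {E : Type*} [NormedAddCommGroup E] [InnerProductSpace 𝕜 E]

theorem isCompactOperator_rankOne (u v : E) : IsCompactOperator (rankOne 𝕜 u v : E →L[𝕜] E) := by
  rw [rankOne_def']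
  exact (isCompactOperator_of_locallyCompactSpace_dom (innerSL 𝕜 v)).clm_comp
    (ContinuousLinearMap.toSpanSingleton 𝕜 u)

theorem rankOne_mem_of_ne_bot {S : Submodule 𝕜 (E →L[𝕜] E)} (hS : S ≠ ⊥)
    (h_left : ∀ u v, ∀ T ∈ S, rankOne 𝕜 u v * T ∈ S)
    (h_right : ∀ u v, ∀ T ∈ S, T * rankOne 𝕜 u v ∈ S) (u v : E) : rankOne 𝕜 u v ∈ S := by
  obtain ⟨T, hTS, hT⟩ := S.ne_bot_iff.1 hS
  obtain ⟨x, hx⟩ : ∃ x, T x ≠ 0 := DFunLike.ne_iff.1 hT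
  have hcomp : rankOne 𝕜 u (T x) ∘L T ∘L rankOne 𝕜 x v =
      inner 𝕜 (T x) (T x) • rankOne 𝕜 u v := by
    rw [comp_rankOne, rankOne_comp_rankOne]
  rw [← S.smul_mem_iff (inner_self_ne_zero (𝕜 := 𝕜).2 hx), ← hcomp]
  exact h_left _ _ _ (h_right _ _ _ hTS)

theorem rankOne_mem_of_dense_span {S : Submodule 𝕜 (E →L[𝕜] E)}
    (hS : IsClosed (S : Set (E →L[𝕜] E))) {D : Set E}
    (hD : Dense (Submodule.span 𝕜 D : Set E))
    (h : ∀ u ∈ D, ∀ v ∈ D, rankOne 𝕜 u v ∈ S) (u v : E) : rankOne 𝕜 u v ∈ S := by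
  have h_right : ∀ u ∈ D, ∀ v, rankOne 𝕜 u v ∈ S := fun u hu v =>
    hD.induction (fun _ hv => (Submodule.span_le (p := S.comap (rankOne 𝕜 u).toLinearMap)).2
      (h u hu) hv) (hS.preimage (rankOne 𝕜 u).continuous) v
  let rankOneLeft : E →L[𝕜] E →L[𝕜] E :=
    ContinuousLinearMap.apply' (E →L[𝕜] E) (starRingEnd 𝕜) v ∘L rankOne 𝕜
  exact hD.induction (fun _ hu => (Submodule.span_le (p := S.comap rankOneLeft.toLinearMap)).2
      (fun u hu => h_right u hu v) hu) (hS.preimage rankOneLeft.continuous) u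

theorem exists_norm_starProjection_comp_sub_lt {T : E →L[𝕜] E} (hT : IsCompactOperator T)
    {ε : ℝ} (hε : 0 < ε) :
    ∃ (V : Submodule 𝕜 E) (_ : FiniteDimensional 𝕜 V), ‖V.starProjection ∘L T - T‖ < ε := by
  have hball : TotallyBounded (T '' Metric.closedBall 0 1) :=
    (hT.isCompact_closure_image_closedBall (f := (T : E →ₗ[𝕜] E)) 1).totallyBounded.subset
      subset_closure
  obtain ⟨t, ht, hcover⟩ := Metric.totallyBounded_iff.1 hball (ε / 2) (half_pos hε)
  have : FiniteDimensional 𝕜 (Submodule.span 𝕜 t) := FiniteDimensional.span_of_finite 𝕜 ht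
  refine ⟨Submodule.span 𝕜 t, this, lt_of_le_of_lt ?_ (half_lt_self hε)⟩
  refine ContinuousLinearMap.opNorm_le_of_unit_norm (by positivity) fun x hx => ?_
  obtain ⟨y, hy, hxy⟩ := Set.mem_iUnion₂.1 (hcover ⟨x, by simp [hx], rfl⟩)
  rw [sub_apply, ContinuousLinearMap.comp_apply, norm_sub_rev, Submodule.starProjection_minimal]
  calc ⨅ z : Submodule.span 𝕜 t, ‖T x - z‖ ≤ ‖T x - y‖ :=
        ciInf_le ⟨0, by rintro _ ⟨z, rfl⟩; positivity⟩
          (⟨y, Submodule.subset_span hy⟩ : Submodule.span 𝕜 t)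
    _ ≤ ε / 2 := by rw [← dist_eq_norm]; exact (Metric.mem_ball.1 hxy).le

variable [CompleteSpace E]

theorem starProjection_comp_mem {S : Submodule 𝕜 (E →L[𝕜] E)} (h : ∀ u v, rankOne 𝕜 u v ∈ S)
    (V : Submodule 𝕜 E) [FiniteDimensional 𝕜 V] (T : E →L[𝕜] E) :
    V.starProjection ∘L T ∈ S := by
  rw [(stdOrthonormalBasis 𝕜 V).starProjection_eq_sum_rankOne, ContinuousLinearMap.finsetSum_comp]
  exact S.sum_mem fun i _ => by rw [rankOne_comp]; exact h _ _

theorem mem_of_isCompactOperator {S : Submodule 𝕜 (E →L[𝕜] E)}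
    (hS : IsClosed (S : Set (E →L[𝕜] E))) (h : ∀ u v, rankOne 𝕜 u v ∈ S)
    {T : E →L[𝕜] E} (hT : IsCompactOperator T) : T ∈ S := by
  rw [← SetLike.mem_coe, ← hS.closure_eq, Metric.mem_closure_iff]
  intro ε hε
  obtain ⟨V, _, hV⟩ := exists_norm_starProjection_comp_sub_lt hT hε
  exact ⟨V.starProjection ∘L T, starProjection_comp_mem h V T, by rwa [dist_comm, dist_eq_norm]⟩

variable {A : StarSubalgebra 𝕜 (E →L[𝕜] E)}

/-- The two-sided ideal of an algebra of operators formed by its compact elements. -/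
noncomputable def compactIdeal (A : StarSubalgebra 𝕜 (E →L[𝕜] E)) : TwoSidedIdeal A :=
  TwoSidedIdeal.mk' {a | IsCompactOperator (a : E →L[𝕜] E)} isCompactOperator_zero
    (fun ha hb => ha.add hb) (fun ha => ha.neg)
    (fun {a _} hb => hb.clm_comp (a : E →L[𝕜] E)) (fun {_ b} ha => ha.comp_clm (b : E →L[𝕜] E))

theorem mem_compactIdeal {a : A} : a ∈ compactIdeal A ↔ IsCompactOperator (a : E →L[𝕜] E) :=
  TwoSidedIdeal.mem_mk' ..

theorem isClosed_compactIdeal : IsClosed (compactIdeal A : Set A) := by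
  have hpre : (compactIdeal A : Set A) = Subtype.val ⁻¹' {T : E →L[𝕜] E | IsCompactOperator T} :=
    Set.ext fun _ => mem_compactIdeal
  rw [hpre]
  exact isClosed_setOfPred_isCompactOperator.preimage continuous_subtype_val

theorem compactIdeal_ne_bot [Nontrivial E] (h : ∀ u v, rankOne 𝕜 u v ∈ A) :
    compactIdeal A ≠ ⊥ := by
  intro hbot
  obtain ⟨u, hu⟩ := exists_ne (0 : E)
  have hmem : (⟨rankOne 𝕜 u u, h u u⟩ : A) ∈ compactIdeal A :=
    mem_compactIdeal.2 (isCompactOperator_rankOne u u)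
  rw [hbot, TwoSidedIdeal.mem_bot] at hmem
  exact rankOne_ne_zero hu hu (congrArg Subtype.val hmem)

theorem compactIdeal_le (hA : IsClosed (A : Set (E →L[𝕜] E))) (h : ∀ u v, rankOne 𝕜 u v ∈ A)
    {J : TwoSidedIdeal A} (hJ : IsClosed (J : Set A)) (hJ_ne : J ≠ ⊥) : compactIdeal A ≤ J := by
  let S : Submodule 𝕜 (E →L[𝕜] E) :=
    (J.asIdeal.restrictScalars 𝕜).map A.toSubalgebra.val.toLinearMap
  have hS_closed : IsClosed (S : Set (E →L[𝕜] E)) :=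
    hA.isClosedEmbedding_subtypeVal.isClosedMap _ hJ
  have hS_ne : S ≠ ⊥ := by
    refine fun hS => hJ_ne (le_bot_iff.1 fun b hb => ?_)
    have hbS : (b : E →L[𝕜] E) ∈ S := ⟨b, hb, rfl⟩
    rw [hS, Submodule.mem_bot] at hbS
    exact (TwoSidedIdeal.mem_bot A).2 (Subtype.ext hbS)
  have hS_rankOne : ∀ u v, rankOne 𝕜 u v ∈ S := by
    refine rankOne_mem_of_ne_bot hS_ne ?_ ?_
    · rintro u v _ ⟨b, hb, rfl⟩
      exact ⟨⟨rankOne 𝕜 u v, h u v⟩ * b, J.mul_mem_left _ _ hb, rfl⟩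
    · rintro u v _ ⟨b, hb, rfl⟩
      exact ⟨b * ⟨rankOne 𝕜 u v, h u v⟩, J.mul_mem_right _ _ hb, rfl⟩
  intro a ha
  obtain ⟨b, hbJ, hba⟩ := mem_of_isCompactOperator hS_closed hS_rankOne (mem_compactIdeal.1 ha)
  rwa [← Subtype.ext hba]

theorem isLeast_compactIdeal [Nontrivial E] (hA : IsClosed (A : Set (E →L[𝕜] E)))
    (h : ∀ u v, rankOne 𝕜 u v ∈ A) : IsLeast (nonzeroClosedIdeals A) (compactIdeal A) :=
  ⟨⟨isClosed_compactIdeal, compactIdeal_ne_bot h⟩, fun _ hJ => compactIdeal_le hA h hJ.1 hJ.2⟩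

theorem image_compactIdeal (hA : IsClosed (A : Set (E →L[𝕜] E))) (h : ∀ u v, rankOne 𝕜 u v ∈ A) :
    Subtype.val '' (compactIdeal A : Set A) = {T : E →L[𝕜] E | IsCompactOperator T} := by
  refine Set.Subset.antisymm (Set.image_subset_iff.2 fun _ => mem_compactIdeal.1) fun T hT => ?_
  have hTA : T ∈ A := mem_of_isCompactOperator (S := A.toSubalgebra.toSubmodule) hA h hT
  exact ⟨⟨T, hTA⟩, mem_compactIdeal.2 hT, rfl⟩

end CompactOperators

section Burnside

theorem exists_smul_eq_of_isSimpleModule (k : Type*) {A V : Type*} [Field k] [IsAlgClosed k]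
    [Ring A] [Algebra k A] [AddCommGroup V] [Module k V] [Module A V] [IsScalarTower k A V]
    [FiniteDimensional k V] [IsSimpleModule A V] (f : Module.End k V) :
    ∃ a : A, ∀ v, a • v = f v := by
  have h_schur := (IsSimpleModule.algebraMap_end_bijective_of_isAlgClosed (A := A) (V := V) k).2
  let f' : Module.End (Module.End A V) V :=
    { f with
      map_smul' := fun g v => by
        obtain ⟨c, rfl⟩ := h_schur g
        exact f.map_smul c v }
  have : Module.Finite (Module.End A V) V := Module.Finite.of_restrictScalars_finite k _ V
  obtain ⟨a, ha⟩ := Module.Finite.toModuleEnd_moduleEnd_surjective (R := A) (M := V) f'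
  exact ⟨a, fun v => DFunLike.congr_fun ha v⟩

variable {Γ : Type*} [Group Γ] {K : Type*} [NormedAddCommGroup K] [InnerProductSpace ℂ K]
  [CompleteSpace K] {σ : URep Γ K}

theorem URep.mem_range_toAlgHom (σ : URep Γ K) (s : Γ) :
    (σ s : K →L[ℂ] K) ∈ σ.toAlgHom.range :=
  ⟨MonoidAlgebra.single s 1, (σ.toAlgHom_single s 1).trans (one_smul _ _)⟩

instance (σ : URep Γ K) : IsScalarTower ℂ σ.toAlgHom.range K := ⟨fun _ _ _ => rfl⟩

theorem URep.IsIrreducible.isSimpleModule [FiniteDimensional ℂ K] (hσ : σ.IsIrreducible) :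
    IsSimpleModule σ.toAlgHom.range K := by
  have := hσ.1
  refine (isSimpleModule_iff _ _).2 { eq_bot_or_eq_top := fun W => ?_ }
  have hW := hσ.2 (W.restrictScalars ℂ) (Submodule.closed_of_finiteDimensional _)
    fun s v hv => W.smul_mem ⟨_, σ.mem_range_toAlgHom s⟩ hv
  simpa only [Submodule.restrictScalars_eq_bot_iff, Submodule.restrictScalars_eq_top_iff] using hW

/-- Burnside's theorem on irreducible matrix algebras. -/
theorem URep.IsIrreducible.toAlgHom_surjective [FiniteDimensional ℂ K] (hσ : σ.IsIrreducible) :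
    Function.Surjective σ.toAlgHom := by
  intro T
  have := hσ.isSimpleModule
  obtain ⟨⟨_, f, rfl⟩, hf⟩ :=
    exists_smul_eq_of_isSimpleModule ℂ (A := σ.toAlgHom.range) (T : Module.End ℂ K)
  exact ⟨f, ContinuousLinearMap.ext hf⟩

end Burnside

section Averages

/-- The parallelogram law combined with the convexity of the square. -/
theorem norm_add_sum_smul_sq_add_sq_le {E : Type*} [NormedAddCommGroup E] [InnerProductSpace ℝ E]
    {ι : Type*} {S : Finset ι} {p : ι → ℝ} (hp : ∀ i ∈ S, 0 ≤ p i) (hp1 : ∑ i ∈ S, p i = 1)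
    {x : E} {u : ι → E} (hu : ∀ i ∈ S, ‖u i‖ = ‖x‖) :
    ‖x + ∑ i ∈ S, p i • u i‖ ^ 2 + (∑ i ∈ S, p i * ‖u i - x‖) ^ 2 ≤ 4 * ‖x‖ ^ 2 := by
  have h_sum : ‖x + ∑ i ∈ S, p i • u i‖ ≤ ∑ i ∈ S, p i * ‖x + u i‖ := by
    have h_eq : x + ∑ i ∈ S, p i • u i = ∑ i ∈ S, p i • (x + u i) := by
      simp only [smul_add, Finset.sum_add_distrib, ← Finset.sum_smul, hp1, one_smul]
    rw [h_eq]
    refine (norm_sum_le _ _).trans (Finset.sum_le_sum fun i hi => ?_)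
    rw [norm_smul, Real.norm_of_nonneg (hp i hi)]
  have h_parallelogram : ∑ i ∈ S, p i * ‖x + u i‖ ^ 2 + ∑ i ∈ S, p i * ‖u i - x‖ ^ 2 =
      4 * ‖x‖ ^ 2 := by
    rw [← Finset.sum_add_distrib, ← mul_one (4 * ‖x‖ ^ 2), ← hp1, Finset.mul_sum]
    refine Finset.sum_congr rfl fun i hi => ?_
    have h_law := parallelogram_law_with_norm ℝ x (u i)
    rw [hu i hi, norm_sub_rev x] at h_law
    linear_combination p i * h_law
  calc ‖x + ∑ i ∈ S, p i • u i‖ ^ 2 + (∑ i ∈ S, p i * ‖u i - x‖) ^ 2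
      ≤ (∑ i ∈ S, p i * ‖x + u i‖) ^ 2 + (∑ i ∈ S, p i * ‖u i - x‖) ^ 2 := by gcongr
    _ ≤ ∑ i ∈ S, p i * ‖x + u i‖ ^ 2 + ∑ i ∈ S, p i * ‖u i - x‖ ^ 2 :=
        add_le_add
          (Real.pow_arith_mean_le_arith_mean_pow S p _ hp hp1 (fun _ _ => norm_nonneg _) 2)
          (Real.pow_arith_mean_le_arith_mean_pow S p _ hp hp1 (fun _ _ => norm_nonneg _) 2)
    _ = 4 * ‖x‖ ^ 2 := h_parallelogram

variable {Γ : Type*} [Group Γ] {E : Type*} [NormedAddCommGroup E] [InnerProductSpace ℂ E]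
  [CompleteSpace E]

/-- The total mass of a nonnegative function of finite support on `Γ`, regarded as an element of
the semigroup algebra. It is multiplicative for the convolution. -/
noncomputable def mass (Γ : Type*) [Group Γ] : MonoidAlgebra ℝ≥0 Γ →ₐ[ℝ≥0] ℝ≥0 :=
  MonoidAlgebra.lift ℝ≥0 ℝ≥0 Γ 1

theorem mass_apply (y : MonoidAlgebra ℝ≥0 Γ) : mass Γ y = y.coeff.sum fun _ c => c := by
  simp [mass, MonoidAlgebra.lift_apply]

/-- The operator `∑ y(s) π(s)` for a nonnegative function `y` of finite support. -/
noncomputable def URep.average (π : URep Γ E) : MonoidAlgebra ℝ≥0 Γ →ₐ[ℝ≥0] (E →L[ℂ] E) :=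
  MonoidAlgebra.lift ℝ≥0 (E →L[ℂ] E) Γ ((unitary (E →L[ℂ] E)).subtype.comp π)

theorem URep.average_apply (π : URep Γ E) (y : MonoidAlgebra ℝ≥0 Γ) (v : E) :
    π.average y v = y.coeff.sum fun s c => c • (π s : E →L[ℂ] E) v := by
  rw [URep.average, MonoidAlgebra.lift_apply, Finsupp.sum, sum_apply]
  rfl

theorem URep.toAlgHom_apply (π : URep Γ E) (f : MonoidAlgebra ℂ Γ) (v : E) :
    π.toAlgHom f v = f.coeff.sum fun s c => c • (π s : E →L[ℂ] E) v := by
  rw [URep.toAlgHom, MonoidAlgebra.lift_apply, Finsupp.sum, sum_apply]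
  rfl

theorem URep.norm_toAlgHom_one_apply (f : MonoidAlgebra ℂ Γ) :
    ‖(1 : URep Γ ℂ).toAlgHom f‖ = ‖f.coeff.sum fun _ c => c‖ := by
  have h_smul : (1 : URep Γ ℂ).toAlgHom f = (f.coeff.sum fun _ c => c) • (1 : ℂ →L[ℂ] ℂ) := by
    ext
    simp [URep.toAlgHom_apply]
  rw [h_smul, norm_smul, norm_one, mul_one]

/-- The mean displacement `∑ y(s) ‖π(s) v - v‖` of the vector `v`. -/
noncomputable def URep.displacement (π : URep Γ E) (y : MonoidAlgebra ℝ≥0 Γ) (v : E) : ℝ :=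
  y.coeff.sum fun s c => c * ‖(π s : E →L[ℂ] E) v - v‖

theorem URep.sub_mul_norm_le_sum_displacement (π : URep Γ E) (f : MonoidAlgebra ℂ Γ) (v : E) :
    (‖(1 : URep Γ ℂ).toAlgHom f‖ - ‖π.toAlgHom f‖) * ‖v‖ ≤
      f.coeff.sum fun s c => ‖c‖ * ‖(π s : E →L[ℂ] E) v - v‖ := by
  set e := f.coeff.sum fun _ c => c with he
  have h_diff : ‖π.toAlgHom f v - e • v‖ ≤
      f.coeff.sum fun s c => ‖c‖ * ‖(π s : E →L[ℂ] E) v - v‖ := by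
    rw [π.toAlgHom_apply, he, Finsupp.sum, Finsupp.sum, Finset.sum_smul,
      ← Finset.sum_sub_distrib]
    refine (norm_sum_le _ _).trans (Finset.sum_le_sum fun s _ => ?_)
    rw [← smul_sub, norm_smul]
  have h_op : ‖π.toAlgHom f v‖ ≤ ‖π.toAlgHom f‖ * ‖v‖ := (π.toAlgHom f).le_opNorm v
  have h_triangle := norm_sub_norm_le (e • v) (π.toAlgHom f v)
  rw [norm_sub_rev, norm_smul] at h_triangle
  rw [URep.norm_toAlgHom_one_apply, sub_mul]
  linarith

theorem URep.exists_mul_norm_le_displacement {π : URep Γ E}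
    (h : ¬ URep.WeaklyContained (1 : URep Γ ℂ) π) :
    ∃ y : MonoidAlgebra ℝ≥0 Γ, mass Γ y = 1 ∧ ∃ η > 0, ∀ v, η * ‖v‖ ≤ π.displacement y v := by
  obtain ⟨f, hf⟩ := not_forall.1 h
  rw [not_le] at hf
  set N : ℝ≥0 := f.coeff.sum fun _ c => ‖c‖₊ with hN
  have hN_le : ‖(1 : URep Γ ℂ).toAlgHom f‖ ≤ N := by
    rw [URep.norm_toAlgHom_one_apply, hN, Finsupp.sum, Finsupp.sum, NNReal.coe_sum]
    exact norm_sum_le _ _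
  have hN_pos : (0 : ℝ) < N := (norm_nonneg _).trans_lt (hf.trans_le hN_le)
  refine ⟨.ofCoeff (f.coeff.mapRange (fun c => ‖c‖₊ / N) (by simp)), ?_,
    (‖(1 : URep Γ ℂ).toAlgHom f‖ - ‖π.toAlgHom f‖) / N, div_pos (sub_pos.2 hf) hN_pos,
    fun v => ?_⟩
  · rw [mass_apply, MonoidAlgebra.coeff_ofCoeff, Finsupp.sum_mapRange_index fun _ => rfl,
      Finsupp.sum, ← Finset.sum_div]
    exact div_self (NNReal.coe_pos.1 hN_pos).ne'
  · rw [URep.displacement, MonoidAlgebra.coeff_ofCoeff, Finsupp.sum_mapRange_index (by simp),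
      div_mul_eq_mul_div, div_le_iff₀ hN_pos, Finsupp.sum_mul]
    refine (π.sub_mul_norm_le_sum_displacement f v).trans_eq (Finset.sum_congr rfl fun s _ => ?_)
    simp only [NNReal.coe_div, coe_nnnorm]
    field_simp

theorem URep.norm_add_average_sq_add_displacement_sq_le (π : URep Γ E) {y : MonoidAlgebra ℝ≥0 Γ}
    (hy : mass Γ y = 1) (v : E) :
    ‖v + π.average y v‖ ^ 2 + π.displacement y v ^ 2 ≤ 4 * ‖v‖ ^ 2 := by
  have h_mass : ∑ s ∈ y.coeff.support, (y.coeff s : ℝ) = 1 := by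
    rw [mass_apply, Finsupp.sum] at hy
    exact_mod_cast hy
  rw [π.average_apply, URep.displacement, Finsupp.sum, Finsupp.sum]
  simp only [NNReal.smul_def]
  let := InnerProductSpace.rclikeToReal ℂ E
  exact norm_add_sum_smul_sq_add_sq_le (fun s _ => NNReal.coe_nonneg _) h_mass
    fun s _ => Unitary.norm_map (π s) v

theorem URep.exists_norm_average_lt_one {π : URep Γ E}
    (h : ¬ URep.WeaklyContained (1 : URep Γ ℂ) π) :
    ∃ y : MonoidAlgebra ℝ≥0 Γ, mass Γ y = 1 ∧ ‖π.average y‖ < 1 := by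
  obtain ⟨y, hy, η, hη, hgap⟩ := URep.exists_mul_norm_le_displacement h
  refine ⟨(2⁻¹ : ℝ≥0) • (1 + y), ?_, ?_⟩
  · rw [map_smul, map_add, map_one, hy, smul_eq_mul, one_add_one_eq_two,
      inv_mul_cancel₀ two_ne_zero]
  refine lt_of_le_of_lt (b := √(1 - η ^ 2 / 4)) ?_ ?_
  · refine ContinuousLinearMap.opNorm_le_bound _ (Real.sqrt_nonneg _) fun v => ?_
    have h_apply : π.average ((2⁻¹ : ℝ≥0) • (1 + y)) v = (2⁻¹ : ℝ) • (v + π.average y v) := by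
      rw [map_smul, map_add, map_one]
      rfl
    have h_sq : ‖v + π.average y v‖ ^ 2 ≤ 4 * ((1 - η ^ 2 / 4) * ‖v‖ ^ 2) := by
      have h_disp : (η * ‖v‖) ^ 2 ≤ π.displacement y v ^ 2 :=
        pow_le_pow_left₀ (by positivity) (hgap v) 2
      linarith [π.norm_add_average_sq_add_displacement_sq_le hy v]
    rw [h_apply, ← Real.sqrt_sq (norm_nonneg v), ← Real.sqrt_mul' _ (sq_nonneg _)]
    refine Real.le_sqrt_of_sq_le ?_
    rw [norm_smul, mul_pow, Real.norm_of_nonneg (by positivity)]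
    linarith
  · rw [Real.sqrt_lt' one_pos]
    linarith [pow_pos hη 2]

end Averages

section Twist

theorem norm_sum_smul_smul_le {ι F : Type*} [NormedAddCommGroup F] [NormedSpace ℂ F]
    (y : ι →₀ ℝ≥0) {φ : ι → ℂ} (hφ : ∀ s, ‖φ s‖ ≤ 1) (u : ι → F) :
    ‖y.sum fun s c => c • φ s • u s‖ ≤ y.sum fun s c => c * ‖u s‖ := by
  refine (norm_sum_le _ _).trans (Finset.sum_le_sum fun s _ => ?_)
  simp only [NNReal.smul_def, norm_smul, NNReal.norm_eq]
  gcongr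
  exact mul_le_of_le_one_left (norm_nonneg _) (hφ s)

variable {Γ : Type*} [Group Γ] {E : Type*} [NormedAddCommGroup E] [InnerProductSpace ℂ E]
  [CompleteSpace E]

/-- The pointwise product `s ↦ y(s) φ(s)` of a nonnegative function `y` of finite support and a
function `φ`, as an element of the complex group algebra. -/
noncomputable def twist (y : MonoidAlgebra ℝ≥0 Γ) (φ : Γ → ℂ) : MonoidAlgebra ℂ Γ :=
  y.coeff.sum fun s c => MonoidAlgebra.single s (c • φ s)

theorem URep.toAlgHom_twist (π : URep Γ E) (y : MonoidAlgebra ℝ≥0 Γ) (φ : Γ → ℂ) :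
    π.toAlgHom (twist y φ) = y.coeff.sum fun s c => c • φ s • (π s : E →L[ℂ] E) := by
  rw [twist, map_finsuppSum]
  simp only [URep.toAlgHom_single, smul_assoc]

theorem URep.toAlgHom_twist_apply (π : URep Γ E) (y : MonoidAlgebra ℝ≥0 Γ) (φ : Γ → ℂ) (v : E) :
    π.toAlgHom (twist y φ) v = y.coeff.sum fun s c => c • φ s • (π s : E →L[ℂ] E) v := by
  rw [π.toAlgHom_twist, Finsupp.sum, sum_apply]
  rfl

theorem URep.norm_toAlgHom_twist_le (π : URep Γ E) (y : MonoidAlgebra ℝ≥0 Γ) {φ : Γ → ℂ}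
    (hφ : ∀ s, ‖φ s‖ ≤ 1) : ‖π.toAlgHom (twist y φ)‖ ≤ mass Γ y := by
  refine ContinuousLinearMap.opNorm_le_bound _ (NNReal.coe_nonneg _) fun v => ?_
  rw [π.toAlgHom_twist_apply]
  refine (norm_sum_smul_smul_le y.coeff hφ _).trans_eq ?_
  simp only [Unitary.norm_map, mass_apply, Finsupp.sum, NNReal.coe_sum, Finset.sum_mul]

theorem URep.sum_inner_toAlgHom_twist {ι : Type*} [Fintype ι] (π : URep Γ E)
    (b : OrthonormalBasis ι ℂ E) (y : MonoidAlgebra ℝ≥0 Γ) (v : E) :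
    ∑ i, inner ℂ (b i)
        (π.toAlgHom (twist y fun s => inner ℂ ((π s : E →L[ℂ] E) v) (b i)) v) =
      mass Γ y • (‖v‖ ^ 2 : ℂ) := by
  simp only [π.toAlgHom_twist_apply, Finsupp.sum, inner_sum]
  rw [Finset.sum_comm, mass_apply, Finsupp.sum, Finset.sum_smul]
  refine Finset.sum_congr rfl fun s _ => ?_
  simp only [NNReal.smul_def, ← Complex.coe_smul, inner_smul_right]
  rw [← Finset.mul_sum, b.sum_inner_mul_inner, inner_self_eq_norm_sq_to_K, Unitary.norm_map]
  rfl

/-- The twists by the matrix coefficients `s ↦ ⟪π(s) v, b i⟫` cannot all tend to zero, because the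
sum in `URep.sum_inner_toAlgHom_twist` is constantly `1` for a unit vector `v`. -/
theorem URep.exists_tendsto_toAlgHom_twist [Nontrivial E] [FiniteDimensional ℂ E] (π : URep Γ E)
    {y : ℕ → MonoidAlgebra ℝ≥0 Γ} (hy : ∀ n, mass Γ (y n) = 1) :
    ∃ φ : Γ → ℂ, (∀ s, ‖φ s‖ ≤ 1) ∧ ∃ t ≠ 0, ∃ k : ℕ → ℕ, StrictMono k ∧
      Tendsto (fun n => π.toAlgHom (twist (y (k n)) φ)) atTop (𝓝 t) := by
  obtain ⟨v, hv⟩ := exists_norm_eq E zero_le_one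
  let b := stdOrthonormalBasis ℂ E
  let φ (i : Fin (Module.finrank ℂ E)) (s : Γ) : ℂ := inner ℂ ((π s : E →L[ℂ] E) v) (b i)
  have hφ : ∀ i s, ‖φ i s‖ ≤ 1 := fun i s => by
    refine (norm_inner_le_norm _ _).trans ?_
    rw [Unitary.norm_map, hv, b.norm_eq_one, one_mul]
  let T (n : ℕ) (i : Fin (Module.finrank ℂ E)) : E →L[ℂ] E := π.toAlgHom (twist (y n) (φ i))
  have hT : ∀ n, T n ∈ Metric.closedBall (0 : Fin (Module.finrank ℂ E) → E →L[ℂ] E) 1 := by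
    intro n
    rw [mem_closedBall_zero_iff, pi_norm_le_iff_of_nonneg zero_le_one]
    intro i
    simpa only [hy, NNReal.coe_one] using π.norm_toAlgHom_twist_le (y n) (hφ i)
  have : ProperSpace (Fin (Module.finrank ℂ E) → E →L[ℂ] E) := FiniteDimensional.proper ℂ _
  obtain ⟨t, -, k, hk, ht⟩ := (isCompact_closedBall _ _).tendsto_subseq hT
  have ht_coord : ∀ i, Tendsto (fun n => T (k n) i) atTop (𝓝 (t i)) := tendsto_pi_nhds.1 ht
  have h_sum : ∑ i, inner ℂ (b i) (t i v) = (1 : ℂ) := by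
    refine tendsto_nhds_unique (f := fun n => ∑ i, inner ℂ (b i) (T (k n) i v)) (l := atTop)
      (tendsto_finsetSum _ fun i _ => tendsto_const_nhds.inner ?_)
      (tendsto_const_nhds.congr fun n => ?_)
    · exact ((ContinuousLinearMap.apply ℂ E v).continuous.tendsto _).comp (ht_coord i)
    · rw [π.sum_inner_toAlgHom_twist, hy, hv]
      simp
  obtain ⟨i, hi⟩ : ∃ i, t i ≠ 0 := by
    by_contra! h_zero
    simp [h_zero] at h_sum
  exact ⟨φ i, hφ i, t i, hi, k, hk, ht_coord i⟩

end Twist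

section GeneratedAlgebra

variable {Γ : Type*} [Group Γ] {E : Type*} [NormedAddCommGroup E] [InnerProductSpace ℂ E]
  [CompleteSpace E]

theorem URep.adjoint_apply (π : URep Γ E) (s : Γ) : (π s : E →L[ℂ] E)† = π s⁻¹ := by
  rw [map_inv]
  rfl

theorem URep.isClosed_cstar (π : URep Γ E) : IsClosed (π.cstar : Set (E →L[ℂ] E)) :=
  π.starAlg.isClosed_topologicalClosure

theorem URep.toAlgHom_mem_cstar (π : URep Γ E) (f : MonoidAlgebra ℂ Γ) :
    π.toAlgHom f ∈ π.cstar :=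
  π.starAlg.le_topologicalClosure ⟨f, rfl⟩

theorem URep.apply_mem_cstar (π : URep Γ E) (s : Γ) : (π s : E →L[ℂ] E) ∈ π.cstar := by
  simpa only [π.toAlgHom_single, one_smul] using π.toAlgHom_mem_cstar (MonoidAlgebra.single s 1)

theorem URep.cstar_comp_le {Λ : Type*} [Group Λ] (π : URep Γ E) (f : Λ →* Γ) :
    URep.cstar (π.comp f) ≤ π.cstar := by
  refine StarSubalgebra.topologicalClosure_minimal ?_ π.isClosed_cstar
  rintro _ ⟨x, rfl⟩
  change URep.toAlgHom (π.comp f) x ∈ π.cstar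
  induction x using MonoidAlgebra.induction_linear with
  | zero => rw [map_zero]; exact zero_mem _
  | add x y hx hy => rw [map_add]; exact add_mem hx hy
  | single s c =>
    rw [URep.toAlgHom_single]
    exact π.cstar.smul_mem (π.apply_mem_cstar (f s)) c

end GeneratedAlgebra

section Intertwiners

variable {Γ : Type*} [Group Γ] {E : Type*} [NormedAddCommGroup E] [InnerProductSpace ℂ E]
  [CompleteSpace E] {K : Type*} [NormedAddCommGroup K] [InnerProductSpace ℂ K] [CompleteSpace K]
  {F : Type*} [NormedAddCommGroup F] [InnerProductSpace ℂ F] [CompleteSpace F]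
  {π : URep Γ E} {σ : URep Γ K} {ρ : URep Γ F} {V : E →L[ℂ] K}

/-- The operator `V` intertwines the representations `π` and `σ`. -/
def URep.Intertwines (π : URep Γ E) (σ : URep Γ K) (V : E →L[ℂ] K) : Prop :=
  ∀ s, V ∘L (π s : E →L[ℂ] E) = (σ s : K →L[ℂ] K) ∘L V

theorem URep.Intertwines.adjoint (hV : π.Intertwines σ V) : σ.Intertwines π (V†) := by
  intro s
  have h_adjoint := congrArg ContinuousLinearMap.adjoint (hV s⁻¹)
  simpa only [ContinuousLinearMap.adjoint_comp, URep.adjoint_apply, inv_inv] using h_adjoint.symm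

theorem URep.Intertwines.comp_toAlgHom (hV : π.Intertwines σ V) (f : MonoidAlgebra ℂ Γ) :
    V ∘L π.toAlgHom f = σ.toAlgHom f ∘L V := by
  induction f using MonoidAlgebra.induction_linear with
  | zero => simp only [map_zero, ContinuousLinearMap.comp_zero, ContinuousLinearMap.zero_comp]
  | add f g hf hg =>
    simp only [map_add, ContinuousLinearMap.comp_add, ContinuousLinearMap.add_comp, hf, hg]
  | single s c =>
    simp only [URep.toAlgHom_single, ContinuousLinearMap.comp_smul, ContinuousLinearMap.smul_comp,
      hV s]

/-- The map `t ↦ V* t V`. If `V V* = 1`, it extends operators by zero from the copy of `K` in `E`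
that is the range of `V*`. -/
noncomputable def dilate (V : E →L[ℂ] K) : (K →L[ℂ] K) →L[ℂ] (E →L[ℂ] E) :=
  (V†).postcomp E ∘L V.precomp K

theorem dilate_apply (t : K →L[ℂ] K) : dilate V t = V† ∘L t ∘L V := rfl

theorem dilate_rankOne (u w : K) : dilate V (rankOne ℂ u w) = rankOne ℂ ((V†) u) ((V†) w) := by
  rw [dilate_apply, rankOne_comp, comp_rankOne]

theorem URep.Intertwines.dilate_toAlgHom_mul (hV : π.Intertwines σ V) (f : MonoidAlgebra ℂ Γ)
    (t : K →L[ℂ] K) : dilate V (σ.toAlgHom f * t) = π.toAlgHom f * dilate V t := by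
  simp only [dilate_apply, ContinuousLinearMap.mul_def, ← ContinuousLinearMap.comp_assoc,
    hV.adjoint.comp_toAlgHom f]

theorem URep.Intertwines.dilate_mul_toAlgHom (hV : π.Intertwines σ V) (f : MonoidAlgebra ℂ Γ)
    (t : K →L[ℂ] K) : dilate V (t * σ.toAlgHom f) = dilate V t * π.toAlgHom f := by
  simp only [dilate_apply, ContinuousLinearMap.mul_def, ContinuousLinearMap.comp_assoc,
    hV.comp_toAlgHom f]

/-- On the subspace `W`, the operators `∑ y(s) φ(s) π(s)` with `|φ| ≤ 1` are bounded by
the norm of the positive average `∑ y(s) ρ(s)`, whatever the phases of `φ`. -/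
def URep.IsDominatedOn (π : URep Γ E) (ρ : URep Γ F) (W : Submodule ℂ E) : Prop :=
  ∀ (y : MonoidAlgebra ℝ≥0 Γ) (φ : Γ → ℂ), (∀ s, ‖φ s‖ ≤ 1) →
    ∀ v ∈ W, ‖π.toAlgHom (twist y φ) v‖ ≤ ‖ρ.average y‖ * ‖v‖

theorem URep.IsDominatedOn.norm_toAlgHom_twist_sub_dilate_le
    (h_dom : π.IsDominatedOn ρ V.ker) (hV : π.Intertwines σ V) (hVV : V ∘L V† = 1)
    (y : MonoidAlgebra ℝ≥0 Γ) {φ : Γ → ℂ} (hφ : ∀ s, ‖φ s‖ ≤ 1) :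
    ‖π.toAlgHom (twist y φ) - dilate V (σ.toAlgHom (twist y φ))‖ ≤
      ‖ρ.average y‖ * ‖1 - V† ∘L V‖ := by
  have h_factor : π.toAlgHom (twist y φ) - dilate V (σ.toAlgHom (twist y φ)) =
      π.toAlgHom (twist y φ) * (1 - V† ∘L V) := by
    rw [mul_sub, mul_one, ← mul_one (σ.toAlgHom _), hV.dilate_toAlgHom_mul]
    rfl
  have h_ker : ∀ v, (1 - V† ∘L V) v ∈ V.ker := by
    intro v
    have h_proj : V ((V†) (V v)) = V v := DFunLike.congr_fun hVV (V v)
    change V (v - (V†) (V v)) = 0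
    rw [map_sub, h_proj, sub_self]
  rw [h_factor]
  refine ContinuousLinearMap.opNorm_le_bound _ (by positivity) fun v => ?_
  rw [mul_assoc]
  exact (h_dom y φ hφ _ (h_ker v)).trans
    (mul_le_mul_of_nonneg_left ((1 - V† ∘L V).le_opNorm v) (norm_nonneg _))

theorem URep.IsDominatedOn.exists_dilate_mem_cstar [Nontrivial K] [FiniteDimensional ℂ K]
    (h_dom : π.IsDominatedOn ρ V.ker) (hρ : ¬ URep.WeaklyContained (1 : URep Γ ℂ) ρ)
    (hV : π.Intertwines σ V) (hVV : V ∘L V† = 1) : ∃ t ≠ 0, dilate V t ∈ π.cstar := by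
  obtain ⟨y, hy_mass, hy_norm⟩ := URep.exists_norm_average_lt_one hρ
  obtain ⟨φ, hφ, t, ht, k, hk, h_lim⟩ := σ.exists_tendsto_toAlgHom_twist
    (y := fun n => y ^ n) fun n => by rw [map_pow, hy_mass, one_pow]
  refine ⟨t, ht, ?_⟩
  have h_pow : Tendsto (fun n => ‖ρ.average (y ^ k n)‖ * ‖1 - V† ∘L V‖) atTop (𝓝 0) := by
    have h_tendsto := ((tendsto_pow_atTop_nhds_zero_of_norm_lt_one hy_norm).comp
      hk.tendsto_atTop).norm.mul_const ‖1 - V† ∘L V‖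
    simpa only [map_pow, Function.comp_def, norm_zero, zero_mul] using h_tendsto
  have h_sub : Tendsto (fun n => π.toAlgHom (twist (y ^ k n) φ) -
      dilate V (σ.toAlgHom (twist (y ^ k n) φ))) atTop (𝓝 0) :=
    squeeze_zero_norm (fun n => h_dom.norm_toAlgHom_twist_sub_dilate_le hV hVV _ hφ) h_pow
  have h_dilate := ((dilate V).continuous.tendsto t).comp h_lim
  refine π.isClosed_cstar.mem_of_tendsto (b := atTop) ?_
    (Eventually.of_forall fun n => π.toAlgHom_mem_cstar (twist (y ^ k n) φ))
  simpa only [Function.comp_def, sub_add_cancel, zero_add] using h_sub.add h_dilate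

theorem URep.IsDominatedOn.rankOne_adjoint_mem_cstar [FiniteDimensional ℂ K]
    (h_dom : π.IsDominatedOn ρ V.ker) (hρ : ¬ URep.WeaklyContained (1 : URep Γ ℂ) ρ)
    (hσ : σ.IsIrreducible) (hV : π.Intertwines σ V) (hVV : V ∘L V† = 1) (u w : K) :
    rankOne ℂ ((V†) u) ((V†) w) ∈ π.cstar := by
  have := hσ.1
  let S : Submodule ℂ (K →L[ℂ] K) :=
    π.cstar.toSubalgebra.toSubmodule.comap (dilate V).toLinearMap
  obtain ⟨t, ht, htS⟩ := h_dom.exists_dilate_mem_cstar hρ hV hVV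
  rw [← dilate_rankOne]
  refine rankOne_mem_of_ne_bot (S := S) (S.ne_bot_iff.2 ⟨t, htS, ht⟩) ?_ ?_ u w
  · intro a b T hT
    obtain ⟨f, hf⟩ := hσ.toAlgHom_surjective (rankOne ℂ a b)
    rw [← hf, Submodule.mem_comap]
    exact (hV.dilate_toAlgHom_mul f T).symm ▸ π.cstar.mul_mem (π.toAlgHom_mem_cstar f) hT
  · intro a b T hT
    obtain ⟨f, hf⟩ := hσ.toAlgHom_surjective (rankOne ℂ a b)
    rw [← hf, Submodule.mem_comap]
    exact (hV.dilate_mul_toAlgHom f T).symm ▸ π.cstar.mul_mem hT (π.toAlgHom_mem_cstar f)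

end Intertwiners

section Ell2

theorem Ell2.norm_mono {X : Type*} {f g : Ell2 X} (h : ∀ x, ‖f x‖ ≤ ‖g x‖) : ‖f‖ ≤ ‖g‖ := by
  rw [← sq_le_sq₀ (norm_nonneg _) (norm_nonneg _), norm_sq_eq_tsum, norm_sq_eq_tsum]
  refine Summable.tsum_le_tsum (fun x => ?_) ((memℓp_two_iff _).1 f.2) ((memℓp_two_iff _).1 g.2)
  gcongr
  exact h x

theorem average_permRep_apply {Γ X : Type*} [Group Γ] [MulAction Γ X] (y : MonoidAlgebra ℝ≥0 Γ)
    (f : Ell2 X) (x : X) :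
    (permRep Γ X).average y f x = y.coeff.sum fun s c => c • f (s⁻¹ • x) := by
  rw [URep.average_apply, Finsupp.sum, lp.coeFn_sum, Finset.sum_apply]
  rfl

end Ell2

section Induced

variable {G : Type*} [Group G] {H : Subgroup G}

theorem out_one_mem : ((1 : G) : G ⧸ H).out ∈ H := by
  simpa using QuotientGroup.eq.1 (QuotientGroup.out_eq' ((1 : G) : G ⧸ H)).symm

variable {K : Type*} [NormedAddCommGroup K] [InnerProductSpace ℂ K] [CompleteSpace K]
  {σ : URep H K}

theorem IndSpace.norm_apply_le (F : IndSpace σ) (x : G) : ‖F x‖ ≤ ‖F‖ := by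
  rw [F.norm_apply_eq (y := (x : G ⧸ H).out) (by simp), ← IndSpace.norm_toLp]
  exact lp.norm_apply_le_norm two_ne_zero (IndSpace.toLp σ F) (x : G ⧸ H)

theorem IndSpace.apply_of_mem (F : IndSpace σ) (h : H) :
    F h = (σ h⁻¹ : K →L[ℂ] K) (F 1) := by
  rw [← F.apply_mul, one_mul]

/-- Evaluation at a point. -/
noncomputable def IndSpace.eval (σ : URep H K) (x : G) : IndSpace σ →L[ℂ] K :=
  LinearMap.mkContinuous
    { toFun := fun F => F x
      map_add' := fun _ _ => rfl
      map_smul' := fun _ _ => rfl } 1 fun F => (F.norm_apply_le x).trans_eq (one_mul _).symm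

theorem IndSpace.eval_apply (F : IndSpace σ) (x : G) : IndSpace.eval σ x F = F x := rfl

theorem IndSpace.intertwines_eval_one (σ : URep H K) :
    URep.Intertwines ((indRep σ).comp H.subtype) σ (IndSpace.eval σ 1) := by
  intro s
  ext F
  change F ((s : G)⁻¹ * 1) = (σ s : K →L[ℂ] K) (F 1)
  rw [mul_one, ← Subgroup.coe_inv, F.apply_of_mem, inv_inv]

open Classical in
/-- The vector with value `u` at the identity that vanishes outside `H`. As `IndSpace.toLp` reads
functions at coset representatives, its entry at the coset `H` is the value at `out ∈ H`. -/
noncomputable def IndSpace.base (σ : URep H K) (u : K) : IndSpace σ :=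
  (IndSpace.toLp σ).symm
    (lp.single 2 ((1 : G) : G ⧸ H) ((σ ⟨_, out_one_mem⟩⁻¹ : K →L[ℂ] K) u))

theorem IndSpace.toLp_apply_one (F : IndSpace σ) :
    IndSpace.toLp σ F ((1 : G) : G ⧸ H) = (σ ⟨_, out_one_mem⟩⁻¹ : K →L[ℂ] K) (F 1) :=
  F.apply_of_mem ⟨_, out_one_mem⟩

theorem IndSpace.base_apply_one (u : K) : IndSpace.base σ u 1 = u := by
  classical
  refine (Unitary.linearIsometryEquiv (σ ⟨_, out_one_mem⟩⁻¹)).injective ?_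
  refine (IndSpace.toLp_apply_one _).symm.trans ?_
  rw [IndSpace.base, LinearEquiv.apply_symm_apply]
  exact lp.single_apply_self _ _ _

theorem IndSpace.inner_base (u : K) (F : IndSpace σ) :
    inner ℂ (IndSpace.base σ u) F = inner ℂ u (F 1) := by
  classical
  change inner ℂ (IndSpace.toLp σ (IndSpace.base σ u)) (IndSpace.toLp σ F) = _
  rw [IndSpace.base, LinearEquiv.apply_symm_apply, lp.inner_single_left, F.toLp_apply_one]
  exact (Unitary.linearIsometryEquiv (σ ⟨_, out_one_mem⟩⁻¹)).inner_map_map u (F 1)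

theorem IndSpace.adjoint_eval_one (σ : URep H K) (u : K) :
    ((IndSpace.eval σ 1)†) u = IndSpace.base σ u := by
  refine ext_inner_right ℂ fun F => ?_
  rw [ContinuousLinearMap.adjoint_inner_left, IndSpace.inner_base, IndSpace.eval_apply]

theorem IndSpace.eval_one_comp_adjoint (σ : URep H K) :
    IndSpace.eval σ 1 ∘L (IndSpace.eval σ 1)† = 1 := by
  ext u
  change IndSpace.eval σ 1 (((IndSpace.eval σ 1)†) u) = u
  rw [IndSpace.adjoint_eval_one, IndSpace.eval_apply, IndSpace.base_apply_one]

theorem IndSpace.nontrivial [Nontrivial K] (σ : URep H K) : Nontrivial (IndSpace σ) :=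
  Function.Surjective.nontrivial (f := IndSpace.eval σ 1) fun u =>
    ⟨IndSpace.base σ u, IndSpace.base_apply_one u⟩

theorem IndSpace.dense_span_translates (σ : URep H K) :
    Dense (Submodule.span ℂ {F | ∃ (g : G) (u : K),
      (indRep σ g : IndSpace σ →L[ℂ] IndSpace σ) (IndSpace.base σ u) = F} :
        Set (IndSpace σ)) := by
  rw [Submodule.dense_iff_topologicalClosure_eq_top, Submodule.topologicalClosure_eq_top_iff,
    Submodule.eq_bot_iff]
  intro F hF
  refine IndSpace.ext fun g => ?_
  have h_orth := (Submodule.mem_orthogonal _ _).1 hF _ (Submodule.subset_span ⟨g, F g, rfl⟩)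
  rwa [← ContinuousLinearMap.adjoint_inner_right, URep.adjoint_apply, IndSpace.inner_base,
    indRep_apply, inv_inv, mul_one, inner_self_eq_zero] at h_orth

/-- The function `‖F‖` on the cosets other than `H`, as a vector of the space on which the
spectral gap is assumed. -/
noncomputable def IndSpace.absOff (F : IndSpace σ) : Ell2 (cosetsNeBase H) :=
  ⟨fun q => (‖F (q : G ⧸ H).out‖ : ℂ), (memℓp_two_iff _).2 (by
    simp only [Complex.norm_real, norm_norm]
    exact F.summable.subtype (cosetsNeBase H : Set (G ⧸ H)))⟩

theorem IndSpace.absOff_apply (F : IndSpace σ) (q : cosetsNeBase H) :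
    F.absOff q = (‖F (q : G ⧸ H).out‖ : ℂ) := rfl

theorem IndSpace.norm_absOff {F : IndSpace σ} (hF : F 1 = 0) : ‖F.absOff‖ = ‖F‖ := by
  rw [← sq_eq_sq₀ (norm_nonneg _) (norm_nonneg _), norm_sq_eq_tsum, IndSpace.norm_sq]
  simp only [IndSpace.absOff_apply, Complex.norm_real, norm_norm]
  refine tsum_subtype_eq_of_support_subset (f := fun q : G ⧸ H => ‖F q.out‖ ^ 2)
    (s := (cosetsNeBase H : Set (G ⧸ H))) fun q hq hq1 => hq ?_
  obtain rfl : q = ((1 : G) : G ⧸ H) := hq1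
  have h_out : F ((1 : G) : G ⧸ H).out = 0 := by
    rw [F.apply_of_mem ⟨_, out_one_mem⟩, hF, map_zero]
  simp [h_out]

theorem IndSpace.average_absOff_apply (y : MonoidAlgebra ℝ≥0 H) (F : IndSpace σ)
    (q : cosetsNeBase H) :
    (permRep H (cosetsNeBase H)).average y F.absOff q =
      ((y.coeff.sum fun s c => c * ‖F ((s : G)⁻¹ * (q : G ⧸ H).out)‖ : ℝ) : ℂ) := by
  rw [average_permRep_apply, Finsupp.sum, Finsupp.sum, Complex.ofReal_sum]
  refine Finset.sum_congr rfl fun s _ => ?_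
  rw [IndSpace.norm_translate, Complex.ofReal_mul]
  rfl

theorem IndSpace.toAlgHom_twist_apply (y : MonoidAlgebra ℝ≥0 H) (φ : H → ℂ) (F : IndSpace σ)
    (x : G) :
    URep.toAlgHom ((indRep σ).comp H.subtype) (twist y φ) F x =
      y.coeff.sum fun s c => c • φ s • F ((s : G)⁻¹ * x) := by
  rw [URep.toAlgHom_twist_apply, ← IndSpace.eval_apply, Finsupp.sum, map_sum]
  rfl

theorem IndSpace.isDominatedOn_ker_eval_one (σ : URep H K) :
    URep.IsDominatedOn ((indRep σ).comp H.subtype) (permRep H (cosetsNeBase H))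
      (IndSpace.eval σ 1).ker := by
  intro y φ hφ F hF
  set T := URep.toAlgHom ((indRep σ).comp H.subtype) (twist y φ)
  set A := (permRep H (cosetsNeBase H)).average y
  have hF_one : F 1 = 0 := hF
  have hT_one : T F 1 = 0 := by
    have h_comp := (IndSpace.intertwines_eval_one σ).comp_toAlgHom (twist y φ)
    refine (DFunLike.congr_fun h_comp F).trans ?_
    rw [ContinuousLinearMap.comp_apply, IndSpace.eval_apply, hF_one, map_zero]
  have h_pointwise : ∀ q, ‖(T F).absOff q‖ ≤ ‖A F.absOff q‖ := by
    intro q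
    rw [IndSpace.average_absOff_apply, IndSpace.absOff_apply, Complex.norm_real, Complex.norm_real,
      norm_norm, IndSpace.toAlgHom_twist_apply]
    exact (norm_sum_smul_smul_le _ hφ _).trans (le_abs_self _)
  rw [← IndSpace.norm_absOff hT_one, ← IndSpace.norm_absOff hF_one]
  exact (Ell2.norm_mono h_pointwise).trans (A.le_opNorm _)

theorem rankOne_mem_cstar_indRep [FiniteDimensional ℂ K] (hH : SpectralGapProperty H)
    (hσ : σ.IsIrreducible) (F₁ F₂ : IndSpace σ) : rankOne ℂ F₁ F₂ ∈ (indRep σ).cstar := by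
  have h_base : ∀ u w, rankOne ℂ (IndSpace.base σ u) (IndSpace.base σ w) ∈ (indRep σ).cstar := by
    intro u w
    have h_mem := (IndSpace.isDominatedOn_ker_eval_one σ).rankOne_adjoint_mem_cstar hH hσ
      (IndSpace.intertwines_eval_one σ) (IndSpace.eval_one_comp_adjoint σ) u w
    rw [IndSpace.adjoint_eval_one, IndSpace.adjoint_eval_one] at h_mem
    exact (indRep σ).cstar_comp_le H.subtype h_mem
  refine rankOne_mem_of_dense_span (S := (indRep σ).cstar.toSubalgebra.toSubmodule)
    (indRep σ).isClosed_cstar (IndSpace.dense_span_translates σ) ?_ F₁ F₂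
  rintro _ ⟨g, u, rfl⟩ _ ⟨g', w, rfl⟩
  have h_translate : rankOne ℂ ((indRep σ g : IndSpace σ →L[ℂ] IndSpace σ) (IndSpace.base σ u))
      ((indRep σ g' : IndSpace σ →L[ℂ] IndSpace σ) (IndSpace.base σ w)) =
      (indRep σ g : IndSpace σ →L[ℂ] IndSpace σ) *
        (rankOne ℂ (IndSpace.base σ u) (IndSpace.base σ w) * (indRep σ g'⁻¹)) := by
    simp only [ContinuousLinearMap.mul_def, rankOne_comp, comp_rankOne, URep.adjoint_apply, inv_inv]
  rw [h_translate]
  exact (indRep σ).cstar.mul_mem ((indRep σ).apply_mem_cstar g)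
    ((indRep σ).cstar.mul_mem (h_base u w) ((indRep σ).apply_mem_cstar g'⁻¹))

end Induced

end SpectralGapInd

theorem mainTheorem3_general {G : Type*} [Group G] (H : Subgroup G)
    (hH : SpectralGapInd.SpectralGapProperty H)
    {K : Type*} [NormedAddCommGroup K] [InnerProductSpace ℂ K] [CompleteSpace K]
    [FiniteDimensional ℂ K] (σ : SpectralGapInd.URep H K) (hσ : σ.IsIrreducible) :
    ∃ I : TwoSidedIdeal (SpectralGapInd.indRep σ).cstar,
      IsLeast (SpectralGapInd.nonzeroClosedIdeals (SpectralGapInd.indRep σ).cstar) I ∧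
      (∀ I' : TwoSidedIdeal (SpectralGapInd.indRep σ).cstar,
        IsLeast (SpectralGapInd.nonzeroClosedIdeals (SpectralGapInd.indRep σ).cstar) I' →
          I' = I) ∧
      Subtype.val '' (I : Set (SpectralGapInd.indRep σ).cstar) =
        {T : SpectralGapInd.IndSpace σ →L[ℂ] SpectralGapInd.IndSpace σ | IsCompactOperator T} := by
  have := hσ.1
  have := SpectralGapInd.IndSpace.nontrivial σ
  have h_closed := (SpectralGapInd.indRep σ).isClosed_cstar
  have h_rankOne := SpectralGapInd.rankOne_mem_cstar_indRep hH hσ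
  have h_least := SpectralGapInd.isLeast_compactIdeal h_closed h_rankOne
  exact ⟨_, h_least, fun _ h_least' => h_least'.unique h_least,
    SpectralGapInd.image_compactIdeal h_closed h_rankOne⟩

theorem mainTheorem3 {G : Type*} [Group G] [Countable G] (H : Subgroup G)
    (hH : SpectralGapInd.SpectralGapProperty H)
    {K : Type*} [NormedAddCommGroup K] [InnerProductSpace ℂ K] [CompleteSpace K]
    [FiniteDimensional ℂ K] (σ : SpectralGapInd.URep H K) (hσ : σ.IsIrreducible) :
    ∃ I : TwoSidedIdeal (SpectralGapInd.indRep σ).cstar,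
      IsLeast (SpectralGapInd.nonzeroClosedIdeals (SpectralGapInd.indRep σ).cstar) I ∧
      (∀ I' : TwoSidedIdeal (SpectralGapInd.indRep σ).cstar,
        IsLeast (SpectralGapInd.nonzeroClosedIdeals (SpectralGapInd.indRep σ).cstar) I' →
          I' = I) ∧
      Subtype.val '' (I : Set (SpectralGapInd.indRep σ).cstar) =
        {T : SpectralGapInd.IndSpace σ →L[ℂ] SpectralGapInd.IndSpace σ | IsCompactOperator T} :=
  mainTheorem3_general H hH σ hσ
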